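/- Let $\mathcal H$ be a complex Hilbert space (for instance $\mathbb C^N$) and let $\|\cdot\|$ be the operator (spectral) norm on bounded operators. Let $t\ge 0$, let $L\ge 1$ be an integer, and let $H:[0,t]\to B(\mathcal H)$ be a time-dependent Hamiltonian, i.e. a family of bounded self-adjoint operators, that is twice differentiable on $[0,t]$ in operator norm (one-sided at the end points), with derivatives $H'$ and $H''$. Put $\Delta t=t/L$, $t_j=j\,\Delta t$ and $\tilde U_j=e^{-i\,\Delta t\,H(t_j+\Delta t/2)}$ for $0\le j<L$. Then the Dyson series $$\mathcal T\exp\Big(-i\int_0^t H(s)\,ds\Big)=\sum_{n\ge 0}(-i)^n\int_0^t ds_1\int_0^{s_1}ds_2\cdots\int_0^{s_{n-1}}ds_n\,H(s_1)H(s_2)\cdots H(s_n)$$ converges, and $$\Big\|\mathcal T\exp\Big(-i\int_0^t H(s)\,ds\Big)-\tilde U_{L-1}\cdots\tilde U_1\tilde U_0\Big\|\;\le\;\frac{t^3}{L^2}\Big(\frac1{24}\,\|H''\|_{\infty,\infty}+\frac1{12}\,\big\|[H',H]\big\|_{\infty,\infty}\Big),$$ where $\|A\|_{\infty,\infty}=\sup_{s\in[0,t]}\|A(s)\|\in[0,\infty]$,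 $[X,Y]=XY-YX$, and $0\cdot\infty=0$. -/

import Mathlib

open Set
open scoped ENNReal

/-- The `n`-th term of the Dyson series of the time-ordered exponential
`𝒯 exp (-i ∫_a^b H(s) ds)`, that is, the iterated integral
`(-i)^n ∫_a^b ds₁ ∫_a^{s₁} ds₂ ⋯ ∫_a^{sₙ₋₁} dsₙ H(s₁) H(s₂) ⋯ H(sₙ)`
over `b ≥ s₁ ≥ s₂ ≥ ⋯ ≥ sₙ ≥ a`, in which later times stand to the left. -/
noncomputable def dysonTerm {E : Type*} [NormedAddCommGroup E] [InnerProductSpace ℂ E]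
    (H : ℝ → E →L[ℂ] E) (a : ℝ) : ℕ → ℝ → E →L[ℂ] E
  | 0, _ => 1
  | n + 1, b => ∫ s in a..b, (-Complex.I) • (H s * dysonTerm H a n s)

/-- The time-ordered exponential `𝒯 exp (-i ∫_a^b H(s) ds)`: the sum of its Dyson series. -/
noncomputable def timeOrderedExp {E : Type*} [NormedAddCommGroup E] [InnerProductSpace ℂ E]
    (H : ℝ → E →L[ℂ] E) (a b : ℝ) : E →L[ℂ] E :=
  ∑' n : ℕ, dysonTerm H a n b

/-- The `j`-th midpoint step `e^{-i Δ H(t_j + Δ/2)}` with `t_j = j Δ`. -/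
noncomputable def midpointStep {E : Type*} [NormedAddCommGroup E] [InnerProductSpace ℂ E]
    (H : ℝ → E →L[ℂ] E) (Δ : ℝ) (j : ℕ) : E →L[ℂ] E :=
  NormedSpace.exp ((-Complex.I * (Δ : ℂ)) • H ((j : ℝ) * Δ + Δ / 2))

/-- The time-ordered product `Ũ_{L-1} ⋯ Ũ_1 Ũ_0` of the first `L` midpoint steps of length `Δ`. -/
noncomputable def midpointProduct {E : Type*} [NormedAddCommGroup E] [InnerProductSpace ℂ E]
    (H : ℝ → E →L[ℂ] E) (Δ : ℝ) : ℕ → E →L[ℂ] E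
  | 0 => 1
  | L + 1 => midpointStep H Δ L * midpointProduct H Δ L

/-- `‖A‖_{∞,∞}`: the supremum over `s ∈ [0, t]` of the spectral (operator) norm of `A s`,
as an element of `[0, ∞]`. -/
noncomputable def supSpectralNorm {E : Type*} [NormedAddCommGroup E] [InnerProductSpace ℂ E]
    (t : ℝ) (A : ℝ → E →L[ℂ] E) : ℝ≥0∞ :=
  ⨆ s ∈ Icc (0 : ℝ) t, ‖A s‖ₑ

/-! On one step `[a, b]` with midpoint `m`, join the exact propagator to the midpoint exponential by
contracting time towards `m`: the Hamiltonians `s ↦ H (m + μ (s - m))` give `H` at `μ = 1` and the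
constant `H m` at `μ = 0`. By Duhamel's formula the speed of this path in `μ` is at most the norm of
the integral of `(s - m) P(s)* H'(m + μ (s - m)) P(s)`, with `P` the unitary propagator of the
contracted Hamiltonian. The weight `s - m` has mean zero, so the conjugated operator may be replaced
by its difference from its value at `m`. Its derivative in `s` consists of `μ H''` and a commutator
`[H', H]`, so it is Lipschitz with constant `C + M μ`. Since `(s - m)²` integrates to `(b - a)³ /
12`, the speed is at most `(C + M μ) (b - a)³ / 12` (`norm_integral_contraction_variation_le`).
Integrating over `μ ∈ [0, 1]` gives `C / 12 + M / 24`. Unitarity makes the `L` step errors add up.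
-/

/-! ### The Dyson series: convergence, Schrödinger equation, unitarity. -/

section Dyson

section Incomplete

variable {E : Type*} [NormedAddCommGroup E] [InnerProductSpace ℂ E]

lemma timeOrderedExp_self (H : ℝ → E →L[ℂ] E) (a : ℝ) : timeOrderedExp H a a = 1 := by
  rw [timeOrderedExp, tsum_eq_single 0]
  · rfl
  · rintro (_ | n) hn
    · exact absurd rfl hn
    · exact intervalIntegral.integral_same

lemma dysonTerm_congr {H K : ℝ → E →L[ℂ] E} {a b : ℝ} (h : EqOn H K (Icc a b)) (n : ℕ) :
    EqOn (dysonTerm H a n) (dysonTerm K a n) (Icc a b) := by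
  induction n with
  | zero => exact fun _ _ => rfl
  | succ n ih =>
    intro s hs
    refine intervalIntegral.integral_congr fun u hu => ?_
    rw [uIcc_of_le hs.1] at hu
    have hu' : u ∈ Icc a b := ⟨hu.1, hu.2.trans hs.2⟩
    simp only [h hu', ih hu']

end Incomplete

variable {E : Type*} [NormedAddCommGroup E] [InnerProductSpace ℂ E] [CompleteSpace E]
  {H : ℝ → E →L[ℂ] E}

lemma continuous_dysonTerm (hH : Continuous H) (a : ℝ) (n : ℕ) :
    Continuous (dysonTerm H a n) := by
  induction n with
  | zero => exact continuous_const
  | succ n ih =>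
    exact intervalIntegral.continuous_primitive
      (fun _ _ => ((hH.mul ih).const_smul (-Complex.I)).intervalIntegrable _ _) a

lemma hasDerivAt_dysonTerm_succ (hH : Continuous H) (a : ℝ) (n : ℕ) (s : ℝ) :
    HasDerivAt (dysonTerm H a (n + 1)) ((-Complex.I) • (H s * dysonTerm H a n s)) s :=
  ((hH.mul (continuous_dysonTerm hH a n)).const_smul (-Complex.I)).integral_hasStrictDerivAt a s
    |>.hasDerivAt

lemma norm_neg_I_smul_mul_le (A B : E →L[ℂ] E) : ‖(-Complex.I) • (A * B)‖ ≤ ‖A‖ * ‖B‖ := by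
  rw [norm_smul, norm_neg, Complex.norm_I, one_mul]
  exact norm_mul_le _ _

/-- The factorial is the volume of the simplex of ordered times. The absolute value also covers `s <
a`. -/
lemma norm_dysonTerm_le {K : ℝ} (hK : ∀ s, ‖H s‖ ≤ K) (a : ℝ) (n : ℕ) (s : ℝ) :
    ‖dysonTerm H a n s‖ ≤ (K * |s - a|) ^ n / n.factorial := by
  have hK0 : 0 ≤ K := (norm_nonneg _).trans (hK 0)
  induction n generalizing s with
  | zero => 
    rw [pow_zero, Nat.factorial_zero, Nat.cast_one, div_one]
    exact ContinuousLinearMap.norm_id_le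
  | succ n ih =>
    calc ‖dysonTerm H a (n + 1) s‖
        ≤ ∫ u in uIoc a s, ‖(-Complex.I) • (H u * dysonTerm H a n u)‖ :=
          intervalIntegral.norm_integral_le_integral_norm_uIoc
      _ ≤ ∫ u in uIoc a s, K ^ (n + 1) / n.factorial * |u - a| ^ n := by
          refine MeasureTheory.integral_mono_of_nonneg (.of_forall fun _ => norm_nonneg _) ?_
            (.of_forall fun u => ?_)
          · exact (Continuous.integrableOn_uIoc (by fun_prop))
          · calc ‖(-Complex.I) • (H u * dysonTerm H a n u)‖
                ≤ ‖H u‖ * ‖dysonTerm H a n u‖ := norm_neg_I_smul_mul_le _ _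
              _ ≤ K * ((K * |u - a|) ^ n / n.factorial) := by
                  gcongr
                  exacts [hK u, ih u]
              _ = K ^ (n + 1) / n.factorial * |u - a| ^ n := by ring
      _ = (K * |s - a|) ^ (n + 1) / (n + 1).factorial := by
          rw [MeasureTheory.integral_const_mul, integral_pow_abs_sub_uIoc, Nat.factorial_succ]
          push_cast
          field_simp
          ring

lemma summable_dysonTerm {K : ℝ} (hK : ∀ s, ‖H s‖ ≤ K) (a s : ℝ) :
    Summable fun n => dysonTerm H a n s :=
  .of_norm_bounded (Real.summable_pow_div_factorial _) fun n => norm_dysonTerm_le hK a n s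

/-- The time-ordered exponential solves the Schrödinger equation. -/
lemma hasDerivAt_timeOrderedExp {K : ℝ} (hH : Continuous H) (hK : ∀ s, ‖H s‖ ≤ K) (a s : ℝ) :
    HasDerivAt (timeOrderedExp H a) ((-Complex.I) • (H s * timeOrderedExp H a s)) s := by
  have hK0 : 0 ≤ K := (norm_nonneg _).trans (hK 0)
  have hsum : ∀ u, timeOrderedExp H a u = 1 + ∑' n, dysonTerm H a (n + 1) u := fun u =>
    (summable_dysonTerm hK a u).tsum_eq_zero_add
  have key : HasDerivAt (fun u => ∑' n, dysonTerm H a (n + 1) u)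
      (∑' n, (-Complex.I) • (H s * dysonTerm H a n s)) s := by
    have hmem : s ∈ Metric.ball a (|s - a| + 1) := by
      rw [Metric.mem_ball, Real.dist_eq]; linarith
    have hle : ∀ (n : ℕ) (u : ℝ), u ∈ Metric.ball a (|s - a| + 1) →
        ‖(-Complex.I) • (H u * dysonTerm H a n u)‖ ≤
          K * ((K * (|s - a| + 1)) ^ n / n.factorial) := by
      intro n u hu
      rw [Metric.mem_ball, Real.dist_eq] at hu
      have h1 : K * |u - a| ≤ K * (|s - a| + 1) := mul_le_mul_of_nonneg_left hu.le hK0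
      have h2 : ‖dysonTerm H a n u‖ ≤ (K * (|s - a| + 1)) ^ n / n.factorial :=
        (norm_dysonTerm_le hK a n u).trans (div_le_div_of_nonneg_right
          (pow_le_pow_left₀ (by positivity) h1 n) (Nat.cast_nonneg _))
      exact (norm_neg_I_smul_mul_le (H u) (dysonTerm H a n u)).trans
        (mul_le_mul (hK u) h2 (norm_nonneg _) hK0)
    have hu : Summable fun n : ℕ => K * ((K * (|s - a| + 1)) ^ n / (n.factorial : ℝ)) :=
      (Real.summable_pow_div_factorial (K * (|s - a| + 1))).mul_left K
    have hd : ∀ (n : ℕ) (u : ℝ), u ∈ Metric.ball a (|s - a| + 1) →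
        HasDerivAt (dysonTerm H a (n + 1)) ((-Complex.I) • (H u * dysonTerm H a n u)) u :=
      fun n u _ => hasDerivAt_dysonTerm_succ hH a n u
    have h0 : Summable fun n => dysonTerm H a (n + 1) s :=
      (summable_nat_add_iff (f := fun n => dysonTerm H a n s) 1).2 (summable_dysonTerm hK a s)
    exact hasDerivAt_tsum_of_isPreconnected
      (g := fun n u => dysonTerm H a (n + 1) u)
      (g' := fun n u => (-Complex.I) • (H u * dysonTerm H a n u))
      hu Metric.isOpen_ball (convex_ball _ _).isPreconnected hd hle hmem h0 hmem
  have htsum : ∑' n, (-Complex.I) • (H s * dysonTerm H a n s) =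
      (-Complex.I) • (H s * timeOrderedExp H a s) := by
    have h1 := summable_dysonTerm hK a s
    have h2 : Summable fun n => H s * dysonTerm H a n s := h1.mul_left (H s)
    rw [h2.tsum_const_smul, h1.tsum_mul_left, timeOrderedExp]
  rw [htsum] at key
  exact (key.const_add 1).congr_of_eventuallyEq (.of_forall hsum)

lemma hasDerivAt_star_timeOrderedExp {K : ℝ} (hH : Continuous H) (hK : ∀ s, ‖H s‖ ≤ K)
    (hsa : ∀ s, IsSelfAdjoint (H s)) (a s : ℝ) :
    HasDerivAt (fun u => star (timeOrderedExp H a u))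
      (Complex.I • (star (timeOrderedExp H a s) * H s)) s := by
  have h := (hasDerivAt_timeOrderedExp hH hK a s).star
  rwa [star_smul, star_mul, (hsa s).star_eq, star_neg, ← starRingEnd_apply, Complex.conj_I,
    neg_neg] at h

lemma star_timeOrderedExp_mul_self {K : ℝ} (hH : Continuous H) (hK : ∀ s, ‖H s‖ ≤ K)
    (hsa : ∀ s, IsSelfAdjoint (H s)) (a s : ℝ) :
    star (timeOrderedExp H a s) * timeOrderedExp H a s = 1 := by
  have hd : ∀ u, HasDerivAt (fun u => star (timeOrderedExp H a u) * timeOrderedExp H a u) 0 u := by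
    intro u
    refine ((hasDerivAt_star_timeOrderedExp hH hK hsa a u).mul
      (hasDerivAt_timeOrderedExp hH hK a u)).congr_deriv ?_
    simp [mul_assoc]
  have := is_const_of_deriv_eq_zero (fun u => (hd u).differentiableAt) (fun u => (hd u).deriv) s a
  simpa [timeOrderedExp_self] using this

/-- In infinite dimension an isometry need not be unitary, and this product has no evidently zero
derivative. It solves the linear equation `Y' = -i [H, Y]`, as does the constant `1`, so uniqueness
for Lipschitz equations applies. -/
lemma timeOrderedExp_mul_star_self {K : ℝ} (hH : Continuous H) (hK : ∀ s, ‖H s‖ ≤ K)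
    (hsa : ∀ s, IsSelfAdjoint (H s)) (a s : ℝ) :
    timeOrderedExp H a s * star (timeOrderedExp H a s) = 1 := by
  have hd : ∀ u, HasDerivAt (fun u => timeOrderedExp H a u * star (timeOrderedExp H a u))
      ((-Complex.I) • (H u * (timeOrderedExp H a u * star (timeOrderedExp H a u)) -
        (timeOrderedExp H a u * star (timeOrderedExp H a u)) * H u)) u := by
    intro u
    refine ((hasDerivAt_timeOrderedExp hH hK a u).mul
      (hasDerivAt_star_timeOrderedExp hH hK hsa a u)).congr_deriv ?_
    simp [mul_assoc, smul_sub]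
  have hl : ∀ u, LipschitzWith (2 * K).toNNReal
      fun Y : E →L[ℂ] E => (-Complex.I) • (H u * Y - Y * H u) := by
    intro u
    have hK0 : 0 ≤ K := (norm_nonneg _).trans (hK 0)
    refine LipschitzWith.of_dist_le_mul fun Y Z => ?_
    rw [Real.coe_toNNReal _ (by positivity), dist_eq_norm, dist_eq_norm, ← smul_sub, norm_smul,
      norm_neg, Complex.norm_I, one_mul]
    calc ‖H u * Y - Y * H u - (H u * Z - Z * H u)‖ = ‖H u * (Y - Z) - (Y - Z) * H u‖ := by
          congr 1; noncomm_ring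
      _ ≤ ‖H u‖ * ‖Y - Z‖ + ‖Y - Z‖ * ‖H u‖ :=
          (norm_sub_le _ _).trans (add_le_add (norm_mul_le _ _) (norm_mul_le _ _))
      _ ≤ 2 * K * ‖Y - Z‖ := by nlinarith [hK u, norm_nonneg (Y - Z)]
  have h := ODE_solution_unique_univ (t₀ := a) (s := fun _ => univ)
    (v := fun u Y => (-Complex.I) • (H u * Y - Y * H u))
    (K := (2 * K).toNNReal) (g := fun _ => (1 : E →L[ℂ] E))
    (fun u => (hl u).lipschitzOnWith) (fun u => ⟨hd u, mem_univ _⟩)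
    (fun u => ⟨by simpa using hasDerivAt_const u (1 : E →L[ℂ] E), mem_univ _⟩)
    (by simp [timeOrderedExp_self])
  exact congrFun h s

lemma norm_le_one_of_star_mul_self {P : E →L[ℂ] E} (h : star P * P = 1) : ‖P‖ ≤ 1 := by
  have h1 : ‖P‖ * ‖P‖ ≤ 1 := by
    rw [← CStarRing.norm_star_mul_self, h]
    exact ContinuousLinearMap.norm_id_le
  nlinarith [norm_nonneg P]

lemma norm_timeOrderedExp_le_one {K : ℝ} (hH : Continuous H) (hK : ∀ s, ‖H s‖ ≤ K)
    (hsa : ∀ s, IsSelfAdjoint (H s)) (a s : ℝ) : ‖timeOrderedExp H a s‖ ≤ 1 :=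
  norm_le_one_of_star_mul_self (star_timeOrderedExp_mul_self hH hK hsa a s)

lemma eq_timeOrderedExp_mul {K : ℝ} (hH : Continuous H) (hK : ∀ s, ‖H s‖ ≤ K)
    (hsa : ∀ s, IsSelfAdjoint (H s)) {Q : ℝ → E →L[ℂ] E}
    (hQ : ∀ s, HasDerivAt Q ((-Complex.I) • (H s * Q s)) s) (a s : ℝ) :
    Q s = timeOrderedExp H a s * Q a := by
  have hd : ∀ u, HasDerivAt (fun u => star (timeOrderedExp H a u) * Q u) 0 u := by
    intro u
    refine ((hasDerivAt_star_timeOrderedExp hH hK hsa a u).mul (hQ u)).congr_deriv ?_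
    simp [mul_assoc]
  have := is_const_of_deriv_eq_zero (fun u => (hd u).differentiableAt) (fun u => (hd u).deriv) s a
  rw [timeOrderedExp_self, star_one, one_mul] at this
  rw [← this, ← mul_assoc, timeOrderedExp_mul_star_self hH hK hsa, one_mul]

lemma timeOrderedExp_mul_timeOrderedExp {K : ℝ} (hH : Continuous H) (hK : ∀ s, ‖H s‖ ≤ K)
    (hsa : ∀ s, IsSelfAdjoint (H s)) (a b c : ℝ) :
    timeOrderedExp H b c * timeOrderedExp H a b = timeOrderedExp H a c :=
  (eq_timeOrderedExp_mul hH hK hsa (hasDerivAt_timeOrderedExp hH hK a) b c).symm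

lemma timeOrderedExp_const {X : E →L[ℂ] E} (hX : IsSelfAdjoint X) (a b : ℝ) :
    timeOrderedExp (fun _ => X) a b =
      NormedSpace.exp ((-Complex.I * ((b - a : ℝ) : ℂ)) • X) := by
  have hQ : ∀ s : ℝ, HasDerivAt (fun u : ℝ => NormedSpace.exp ((u - a) • ((-Complex.I) • X)))
      ((-Complex.I) • (X * NormedSpace.exp ((s - a) • ((-Complex.I) • X)))) s := by
    intro s
    have h := (hasDerivAt_exp_smul_const' (𝕂 := ℝ) ((-Complex.I) • X) (s - a)).comp_sub_const s a
    rwa [smul_mul_assoc] at h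
  have h := eq_timeOrderedExp_mul (K := ‖X‖) continuous_const (fun _ => le_rfl) (fun _ => hX)
    hQ a b
  rw [sub_self, zero_smul, NormedSpace.exp_zero, mul_one] at h
  rw [← h, mul_comm, mul_smul, Complex.coe_smul]

end Dyson

/-! ### Estimates for vector-valued functions of a real variable. -/

/-- Integrates a speed bound `α + β x` without differentiating `f`. Over `N` equal steps the left
Riemann sums stay below the integral because `β ≥ 0`, and the quadratic errors total `c / N`, which
tends to zero. -/
lemma norm_sub_le_of_increment_le {F : Type*} [NormedAddCommGroup F] {f : ℝ → F} {α β c : ℝ}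
    (hβ : 0 ≤ β)
    (hf : ∀ x y, 0 ≤ x → x ≤ y → y ≤ 1 →
      ‖f y - f x‖ ≤ (α + β * x) * (y - x) + c * (y - x) ^ 2) :
    ‖f 1 - f 0‖ ≤ α + β / 2 := by
  have key : ∀ N : ℕ, 0 < N → ‖f 1 - f 0‖ ≤ α + β / 2 + c / N := by
    intro N hN
    have hN' : (0 : ℝ) < N := by exact_mod_cast hN
    have ind : ∀ k : ℕ, k ≤ N → ‖f (k / N) - f 0‖ ≤
        α * (k / N) + β * (k / N) ^ 2 / 2 + c * (k / N) / N := by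
      intro k
      induction k with
      | zero => simp
      | succ k ih =>
        intro hk
        have h1 := ih (by omega)
        have hstep : ((k + 1 : ℕ) : ℝ) / N = (k : ℝ) / N + 1 / N := by push_cast; ring
        have hx0 : (0 : ℝ) ≤ (k : ℝ) / N := by positivity
        have hd : (0 : ℝ) < 1 / N := by positivity
        have hy1 : (k : ℝ) / N + 1 / N ≤ 1 := by
          rw [← hstep, div_le_one hN']; exact_mod_cast hk
        rw [hstep]
        generalize (k : ℝ) / N = x at *
        rw [div_eq_mul_one_div (c * _) (N : ℝ)] at h1 ⊢
        generalize 1 / (N : ℝ) = d at *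
        have h2 := hf x (x + d) hx0 (by linarith) hy1
        rw [add_sub_cancel_left] at h2
        have h3 : ‖f (x + d) - f 0‖ ≤ ‖f (x + d) - f x‖ + ‖f x - f 0‖ :=
          norm_sub_le_norm_sub_add_norm_sub _ _ _
        nlinarith [mul_nonneg hβ (sq_nonneg d)]
    have h := ind N le_rfl
    rw [div_self hN'.ne'] at h
    simpa using h
  have hlim : Filter.Tendsto (fun N : ℕ => α + β / 2 + c / N) Filter.atTop
      (nhds (α + β / 2 + 0)) :=
    (tendsto_const_div_atTop_nhds_zero_nat c).const_add _
  rw [add_zero] at hlim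
  exact ge_of_tendsto hlim ((Filter.eventually_gt_atTop 0).mono key)

/-- Subtracting the value at the midpoint gains two powers of the length of the interval. -/
lemma norm_integral_sub_midpoint_smul_le {F : Type*} [NormedAddCommGroup F] [NormedSpace ℝ F]
    [CompleteSpace F] {G : ℝ → F} {a b κ : ℝ} (hab : a ≤ b) (hG : ContinuousOn G (Icc a b))
    (hL : ∀ s ∈ Icc a b, ‖G s - G ((a + b) / 2)‖ ≤ κ * |s - (a + b) / 2|) :
    ‖∫ s in a..b, (s - (a + b) / 2) • G s‖ ≤ κ * (b - a) ^ 3 / 12 := by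
  have hG' : ContinuousOn G (uIcc a b) := by rwa [uIcc_of_le hab]
  have hzero : ∫ s in a..b, (s - (a + b) / 2) = 0 := by
    rw [intervalIntegral.integral_sub (by simp) (by simp), integral_id,
      intervalIntegral.integral_const, smul_eq_mul]
    ring
  have hsq : ∫ s in a..b, κ * (s - (a + b) / 2) ^ 2 = κ * (b - a) ^ 3 / 12 := by
    rw [intervalIntegral.integral_const_mul,
      intervalIntegral.integral_comp_sub_right (fun s => s ^ 2), integral_pow]
    push_cast
    ring
  -- The weight has mean zero, so subtracting a constant from `G` is free.
  have heq : ∫ s in a..b, (s - (a + b) / 2) • G s =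
      ∫ s in a..b, (s - (a + b) / 2) • (G s - G ((a + b) / 2)) := by
    simp_rw [smul_sub]
    rw [intervalIntegral.integral_sub, intervalIntegral.integral_smul_const, hzero, zero_smul,
      sub_zero]
    · exact ContinuousOn.intervalIntegrable (by fun_prop)
    · exact ContinuousOn.intervalIntegrable (by fun_prop)
  rw [heq, ← hsq]
  refine intervalIntegral.norm_integral_le_of_norm_le hab (.of_forall fun s hs => ?_)
    (Continuous.intervalIntegrable (by fun_prop) _ _)
  rw [norm_smul, Real.norm_eq_abs]
  calc |s - (a + b) / 2| * ‖G s - G ((a + b) / 2)‖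
      ≤ |s - (a + b) / 2| * (κ * |s - (a + b) / 2|) := by
        gcongr
        exact hL s ⟨hs.1.le, hs.2⟩
    _ = κ * (s - (a + b) / 2) ^ 2 := by rw [← sq_abs (s - (a + b) / 2)]; ring

/-- Two uses of the mean value inequality, without continuity of `f''`. The lost factor `1/2` is
harmless: the bound only enters a quadratic remainder that vanishes in the limit. -/
lemma norm_taylor_sub_le {F : Type*} [NormedAddCommGroup F] [NormedSpace ℝ F]
    {f f' f'' : ℝ → F} {a b M : ℝ}
    (hf : ∀ s ∈ Icc a b, HasDerivWithinAt f (f' s) (Icc a b) s)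
    (hf' : ∀ s ∈ Icc a b, HasDerivWithinAt f' (f'' s) (Icc a b) s)
    (hM : ∀ s ∈ Icc a b, ‖f'' s‖ ≤ M) {x y : ℝ} (hx : x ∈ Icc a b) (hy : y ∈ Icc a b) :
    ‖f y - f x - (y - x) • f' x‖ ≤ M * (y - x) ^ 2 := by
  have hM0 : 0 ≤ M := (norm_nonneg _).trans (hM x hx)
  have hsub : uIcc x y ⊆ Icc a b := ordConnected_Icc.uIcc_subset hx hy
  have h := (convex_uIcc x y).norm_image_sub_le_of_norm_hasDerivWithin_le
    (f := fun s => f s - s • f' x) (f' := fun s => f' s - (1 : ℝ) • f' x) (C := M * |y - x|)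
    (fun s hs => ((hf s (hsub hs)).mono hsub).sub ((hasDerivWithinAt_id s _).smul_const _))
    (fun s hs => ?_) left_mem_uIcc right_mem_uIcc
  · rw [Real.norm_eq_abs, mul_assoc, abs_mul_abs_self, ← sq] at h
    convert h using 2
    rw [sub_smul]
    abel
  · rw [one_smul]
    calc ‖f' s - f' x‖ ≤ M * ‖s - x‖ :=
          (convex_Icc a b).norm_image_sub_le_of_norm_hasDerivWithin_le hf' hM hx (hsub hs)
      _ ≤ M * |y - x| := by
          gcongr
          rw [Real.norm_eq_abs]
          exact abs_sub_left_of_mem_uIcc hs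

/-! ### Perturbation of the propagator. -/

section Step

variable {E : Type*} [NormedAddCommGroup E] [InnerProductSpace ℂ E] [CompleteSpace E]

lemma continuous_timeOrderedExp {A : ℝ → E →L[ℂ] E} {K : ℝ} (hA : Continuous A)
    (hK : ∀ s, ‖A s‖ ≤ K) (a : ℝ) : Continuous (timeOrderedExp A a) :=
  continuous_iff_continuousAt.2 fun s => (hasDerivAt_timeOrderedExp hA hK a s).continuousAt

/-- Duhamel's formula. -/
lemma norm_timeOrderedExp_sub_le_norm_integral {A B : ℝ → E →L[ℂ] E} {K : ℝ}
    (hA : Continuous A) (hAK : ∀ s, ‖A s‖ ≤ K) (hB : Continuous B) (hBK : ∀ s, ‖B s‖ ≤ K)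
    (hBs : ∀ s, IsSelfAdjoint (B s)) (a b : ℝ) :
    ‖timeOrderedExp B a b - timeOrderedExp A a b‖ ≤
      ‖∫ s in a..b, star (timeOrderedExp B a s) * ((B s - A s) * timeOrderedExp A a s)‖ := by
  have hPA := continuous_timeOrderedExp hA hAK a
  have hPB := (continuous_timeOrderedExp hB hBK a).star
  have hd : ∀ s, HasDerivAt (fun s => star (timeOrderedExp B a s) * timeOrderedExp A a s)
      (Complex.I • (star (timeOrderedExp B a s) * ((B s - A s) * timeOrderedExp A a s))) s := by
    intro s
    refine ((hasDerivAt_star_timeOrderedExp hB hBK hBs a s).mul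
      (hasDerivAt_timeOrderedExp hA hAK a s)).congr_deriv ?_
    simp only [mul_assoc, sub_mul, mul_sub, smul_sub, neg_smul, smul_mul_assoc, mul_smul_comm,
      mul_neg]
    abel
  have hint := intervalIntegral.integral_eq_sub_of_hasDerivAt (a := a) (b := b)
    (fun s _ => hd s) (Continuous.intervalIntegrable (by fun_prop) _ _)
  rw [intervalIntegral.integral_smul, timeOrderedExp_self, timeOrderedExp_self, star_one,
    one_mul] at hint
  -- Unitarity of the `B`-propagator reduces the difference to the increment of the product just
  -- integrated.
  have hfac : timeOrderedExp B a b - timeOrderedExp A a b =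
      -(timeOrderedExp B a b * (star (timeOrderedExp B a b) * timeOrderedExp A a b - 1)) := by
    rw [mul_sub, ← mul_assoc, timeOrderedExp_mul_star_self hB hBK hBs, one_mul, mul_one, neg_sub]
  rw [hfac, norm_neg, ← hint]
  refine (norm_mul_le _ _).trans ?_
  rw [norm_smul, Complex.norm_I, one_mul]
  exact mul_le_of_le_one_left (norm_nonneg _) (norm_timeOrderedExp_le_one hB hBK hBs a b)

lemma norm_timeOrderedExp_sub_le {A B : ℝ → E →L[ℂ] E} {K δ : ℝ}
    (hA : Continuous A) (hAK : ∀ s, ‖A s‖ ≤ K) (hAs : ∀ s, IsSelfAdjoint (A s))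
    (hB : Continuous B) (hBK : ∀ s, ‖B s‖ ≤ K) (hBs : ∀ s, IsSelfAdjoint (B s)) {a b : ℝ}
    (hab : a ≤ b) (hδ : ∀ s ∈ Icc a b, ‖B s - A s‖ ≤ δ) :
    ‖timeOrderedExp B a b - timeOrderedExp A a b‖ ≤ δ * (b - a) := by
  refine (norm_timeOrderedExp_sub_le_norm_integral hA hAK hB hBK hBs a b).trans ?_
  rw [← abs_of_nonneg (sub_nonneg.2 hab)]
  refine intervalIntegral.norm_integral_le_of_norm_le_const fun s hs => ?_
  rw [uIoc_of_le hab] at hs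
  calc ‖star (timeOrderedExp B a s) * ((B s - A s) * timeOrderedExp A a s)‖
      ≤ ‖timeOrderedExp B a s‖ * (‖B s - A s‖ * ‖timeOrderedExp A a s‖) := by
        refine (norm_mul_le _ _).trans ?_
        rw [norm_star]
        gcongr
        exact norm_mul_le _ _
    _ ≤ 1 * (δ * 1) := by
        gcongr
        · exact norm_timeOrderedExp_le_one hB hBK hBs a s
        · exact (norm_nonneg _).trans (hδ a ⟨le_rfl, hab⟩)
        · exact hδ s ⟨hs.1.le, hs.2⟩
        · exact norm_timeOrderedExp_le_one hA hAK hAs a s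
    _ = δ := by ring

/-- Along the flow of `A`, the conjugated operator `X` varies at the rate given by its derivative
and its commutator with `A`. -/
lemma hasDerivWithinAt_conj_timeOrderedExp {A X X' : ℝ → E →L[ℂ] E} {K : ℝ} {S : Set ℝ} {s : ℝ}
    (hA : Continuous A) (hAK : ∀ s, ‖A s‖ ≤ K) (hAs : ∀ s, IsSelfAdjoint (A s)) (a : ℝ)
    (hX : HasDerivWithinAt X (X' s) S s) :
    HasDerivWithinAt (fun s => star (timeOrderedExp A a s) * (X s * timeOrderedExp A a s))
      (star (timeOrderedExp A a s) * ((X' s - Complex.I • ⁅X s, A s⁆) * timeOrderedExp A a s))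
      S s := by
  refine ((hasDerivAt_star_timeOrderedExp hA hAK hAs a s).hasDerivWithinAt.mul
    (hX.mul (hasDerivAt_timeOrderedExp hA hAK a s).hasDerivWithinAt)).congr_deriv ?_
  simp only [Pi.mul_apply, Ring.lie_def, mul_assoc, sub_mul, mul_sub, smul_sub, mul_add, neg_smul, smul_mul_assoc,
    mul_smul_comm, mul_neg]
  abel

end Step

/-! ### Dependence on `[0, t]` only. -/

section Incomplete

variable {E : Type*} [NormedAddCommGroup E] [InnerProductSpace ℂ E]

lemma norm_le_toReal_supSpectralNorm {t : ℝ} {A : ℝ → E →L[ℂ] E} (h : supSpectralNorm t A ≠ ⊤)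
    {s : ℝ} (hs : s ∈ Icc 0 t) : ‖A s‖ ≤ (supSpectralNorm t A).toReal := by
  rw [← toReal_enorm]
  exact ENNReal.toReal_mono h (le_iSup₂ (f := fun s (_ : s ∈ Icc 0 t) => ‖A s‖ₑ) s hs)

lemma midpointProduct_congr {H K : ℝ → E →L[ℂ] E} {t Δ : ℝ} (h : EqOn H K (Icc 0 t)) (hΔ : 0 ≤ Δ)
    (n : ℕ) (hn : n * Δ ≤ t) : midpointProduct H Δ n = midpointProduct K Δ n := by
  induction n with
  | zero => rfl
  | succ n ih =>
    push_cast at hn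
    have hmem : (n : ℝ) * Δ + Δ / 2 ∈ Icc 0 t := ⟨by positivity, by linarith⟩
    rw [midpointProduct, midpointProduct, midpointStep, midpointStep, h hmem, ih (by linarith)]

end Incomplete

/-! ### The midpoint rule: one step, then the product. -/

section Midpoint

variable {E : Type*} [NormedAddCommGroup E] [InnerProductSpace ℂ E] [CompleteSpace E]

lemma norm_star_mul_mul_le {P Q X : E →L[ℂ] E} (hQ : ‖Q‖ ≤ 1) :
    ‖star P * (X * Q)‖ ≤ ‖P‖ * ‖X‖ := by
  refine (norm_mul_le _ _).trans ?_
  rw [norm_star]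
  gcongr
  exact (norm_mul_le _ _).trans (mul_le_of_le_one_right (norm_nonneg _) hQ)

lemma midpoint_contraction_mem {a b μ s : ℝ} (hμ0 : 0 ≤ μ) (hμ1 : μ ≤ 1) (hs : s ∈ Icc a b) :
    (a + b) / 2 + μ * (s - (a + b) / 2) ∈ Icc a b := by
  have hm : (a + b) / 2 ∈ Icc a b := ⟨by linarith [hs.1, hs.2], by linarith [hs.1, hs.2]⟩
  have h := (convex_Icc a b).add_smul_sub_mem hm hs ⟨hμ0, hμ1⟩
  simpa using h

/-- The first variation of the time-ordered exponential under a contraction of time towards the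
midpoint. -/
lemma norm_integral_contraction_variation_le {H H' H'' : ℝ → E →L[ℂ] E} {K M C a b μ : ℝ}
    (hab : a ≤ b) (hH : Continuous H) (hK : ∀ s, ‖H s‖ ≤ K) (hsa : ∀ s, IsSelfAdjoint (H s))
    (hH'' : ∀ s ∈ Icc a b, HasDerivWithinAt H' (H'' s) (Icc a b) s)
    (hM : ∀ s ∈ Icc a b, ‖H'' s‖ ≤ M) (hC : ∀ s ∈ Icc a b, ‖⁅H' s, H s⁆‖ ≤ C)
    (hμ0 : 0 ≤ μ) (hμ1 : μ ≤ 1) {P : ℝ → E →L[ℂ] E}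
    (hP : P = timeOrderedExp (fun s => H ((a + b) / 2 + μ * (s - (a + b) / 2))) a) :
    ‖∫ s in a..b, (s - (a + b) / 2) •
        (star (P s) * (H' ((a + b) / 2 + μ * (s - (a + b) / 2)) * P s))‖ ≤
      (C + M * μ) * (b - a) ^ 3 / 12 := by
  set m := (a + b) / 2 with hm
  have hmem : ∀ s ∈ Icc a b, m + μ * (s - m) ∈ Icc a b := fun s hs =>
    midpoint_contraction_mem hμ0 hμ1 hs
  have hA : Continuous fun s => H (m + μ * (s - m)) := by fun_prop
  have hX : ∀ s ∈ Icc a b, HasDerivWithinAt (fun s => H' (m + μ * (s - m)))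
      (μ • H'' (m + μ * (s - m))) (Icc a b) s := by
    intro s hs
    have h1 : HasDerivWithinAt (fun s => m + μ * (s - m)) μ (Icc a b) s := by
      simpa using (((hasDerivAt_id s).sub_const m).const_mul μ).const_add m |>.hasDerivWithinAt
    exact (hH'' _ (hmem s hs)).scomp s h1 hmem
  have hP1 : ∀ u, ‖P u‖ ≤ 1 := fun u =>
    hP ▸ norm_timeOrderedExp_le_one hA (fun _ => hK _) (fun _ => hsa _) a u
  have hG : ∀ s ∈ Icc a b, HasDerivWithinAt
      (fun s => star (P s) * (H' (m + μ * (s - m)) * P s))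
      (star (P s) * ((μ • H'' (m + μ * (s - m)) -
        Complex.I • ⁅H' (m + μ * (s - m)), H (m + μ * (s - m))⁆) * P s)) (Icc a b) s := by
    intro s hs
    rw [hP]
    exact hasDerivWithinAt_conj_timeOrderedExp (X := fun s => H' (m + μ * (s - m)))
      (X' := fun s => μ • H'' (m + μ * (s - m))) hA (fun _ => hK _) (fun _ => hsa _) a (hX s hs)
  -- Only the `H''` term carries the chain-rule factor `μ`; this is why `M` ends with `1/24` and `C`
  -- with `1/12`.
  have hG1 : ∀ u ∈ Icc a b, ‖star (P u) * ((μ • H'' (m + μ * (u - m)) -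
      Complex.I • ⁅H' (m + μ * (u - m)), H (m + μ * (u - m))⁆) * P u)‖ ≤ C + M * μ := by
    intro u hu
    refine (norm_star_mul_mul_le (hP1 u)).trans
      ((mul_le_of_le_one_left (norm_nonneg _) (hP1 u)).trans ?_)
    have h1 : ‖μ • H'' (m + μ * (u - m))‖ ≤ M * μ := by
      rw [norm_smul, Real.norm_of_nonneg hμ0, mul_comm]
      exact mul_le_mul_of_nonneg_right (hM _ (hmem u hu)) hμ0
    have h2 : ‖Complex.I • ⁅H' (m + μ * (u - m)), H (m + μ * (u - m))⁆‖ ≤ C := by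
      rw [norm_smul, Complex.norm_I, one_mul]
      exact hC _ (hmem u hu)
    linarith [norm_sub_le (μ • H'' (m + μ * (u - m)))
      (Complex.I • ⁅H' (m + μ * (u - m)), H (m + μ * (u - m))⁆)]
  have hmm : m ∈ Icc a b := ⟨by linarith, by linarith⟩
  have hGc : ContinuousOn (fun s => star (P s) * (H' (m + μ * (s - m)) * P s)) (Icc a b) :=
    fun s hs => (hG s hs).continuousWithinAt
  have hGL : ∀ s ∈ Icc a b, ‖star (P s) * (H' (m + μ * (s - m)) * P s) -
      star (P m) * (H' (m + μ * (m - m)) * P m)‖ ≤ (C + M * μ) * |s - m| := by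
    intro s hs
    have h := (convex_Icc a b).norm_image_sub_le_of_norm_hasDerivWithin_le hG hG1 hmm hs
    rwa [Real.norm_eq_abs] at h
  exact norm_integral_sub_midpoint_smul_le
    (G := fun s => star (P s) * (H' (m + μ * (s - m)) * P s)) hab hGc hGL

/-- Supplies the hypothesis of `norm_sub_le_of_increment_le` for the path in `μ`: the first
variation gives the linear term, and everything else is of second order in `ν - μ`. -/
lemma norm_timeOrderedExp_contraction_sub_le {H H' H'' : ℝ → E →L[ℂ] E} {K K' M C a b μ ν : ℝ}
    (hab : a ≤ b) (hH : Continuous H) (hK : ∀ s, ‖H s‖ ≤ K) (hsa : ∀ s, IsSelfAdjoint (H s))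
    (hH' : ∀ s ∈ Icc a b, HasDerivWithinAt H (H' s) (Icc a b) s)
    (hH'' : ∀ s ∈ Icc a b, HasDerivWithinAt H' (H'' s) (Icc a b) s)
    (hK' : ∀ s ∈ Icc a b, ‖H' s‖ ≤ K')
    (hM : ∀ s ∈ Icc a b, ‖H'' s‖ ≤ M) (hC : ∀ s ∈ Icc a b, ‖⁅H' s, H s⁆‖ ≤ C)
    (hμ0 : 0 ≤ μ) (hμν : μ ≤ ν) (hν1 : ν ≤ 1) :
    ‖timeOrderedExp (fun s => H ((a + b) / 2 + ν * (s - (a + b) / 2))) a b -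
        timeOrderedExp (fun s => H ((a + b) / 2 + μ * (s - (a + b) / 2))) a b‖ ≤
      (C * (b - a) ^ 3 / 12 + M * (b - a) ^ 3 / 12 * μ) * (ν - μ) +
        ((K' * (b - a) * (b - a)) * (K' * (b - a)) + M * (b - a) ^ 2) * (b - a) *
          (ν - μ) ^ 2 := by
  have hvar := norm_integral_contraction_variation_le hab hH hK hsa hH'' hM hC hμ0
    (hμν.trans hν1) rfl
  set m := (a + b) / 2 with hm
  set A := fun s => H (m + μ * (s - m)) with hAdef
  set B := fun s => H (m + ν * (s - m)) with hBdef
  set P := timeOrderedExp A a with hPdef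
  set Q := timeOrderedExp B a with hQdef
  set X := fun s => H' (m + μ * (s - m)) with hXdef
  have hA : Continuous A := by fun_prop
  have hB : Continuous B := by fun_prop
  have hAK : ∀ s, ‖A s‖ ≤ K := fun _ => hK _
  have hBK : ∀ s, ‖B s‖ ≤ K := fun _ => hK _
  have hAs : ∀ s, IsSelfAdjoint (A s) := fun _ => hsa _
  have hBs : ∀ s, IsSelfAdjoint (B s) := fun _ => hsa _
  have hAm : ∀ s ∈ Icc a b, m + μ * (s - m) ∈ Icc a b := fun s hs =>
    midpoint_contraction_mem hμ0 (hμν.trans hν1) hs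
  have hBm : ∀ s ∈ Icc a b, m + ν * (s - m) ∈ Icc a b := fun s hs =>
    midpoint_contraction_mem (hμ0.trans hμν) hν1 hs
  have hP : Continuous P := continuous_timeOrderedExp hA hAK a
  have hQ : Continuous Q := continuous_timeOrderedExp hB hBK a
  have hP1 : ∀ s, ‖P s‖ ≤ 1 := norm_timeOrderedExp_le_one hA hAK hAs a
  have hQ1 : ∀ s, ‖Q s‖ ≤ 1 := norm_timeOrderedExp_le_one hB hBK hBs a
  have hX : ContinuousOn X (Icc a b) := ContinuousOn.comp (g := H')
    (fun s hs => (hH'' s hs).continuousWithinAt) (by fun_prop) hAm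
  have hδ : 0 ≤ ν - μ := sub_nonneg.2 hμν
  have hba : 0 ≤ b - a := sub_nonneg.2 hab
  have ham : a ∈ Icc a b := ⟨le_rfl, hab⟩
  have hK'0 : 0 ≤ K' := (norm_nonneg _).trans (hK' a ham)
  have hM0 : 0 ≤ M := (norm_nonneg _).trans (hM a ham)
  have hsm : ∀ s ∈ Icc a b, |s - m| ≤ b - a := fun s hs => by
    rw [abs_le]; constructor <;> linarith [hs.1, hs.2]
  have hBA : ∀ s ∈ Icc a b, ‖B s - A s‖ ≤ K' * (b - a) * (ν - μ) := by
    intro s hs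
    refine ((convex_Icc a b).norm_image_sub_le_of_norm_hasDerivWithin_le hH' hK' (hAm s hs)
      (hBm s hs)).trans ?_
    rw [show m + ν * (s - m) - (m + μ * (s - m)) = (ν - μ) * (s - m) by ring, norm_mul,
      Real.norm_of_nonneg hδ, Real.norm_eq_abs]
    calc K' * ((ν - μ) * |s - m|) ≤ K' * ((ν - μ) * (b - a)) := by gcongr; exact hsm s hs
      _ = K' * (b - a) * (ν - μ) := by ring
  have hTay : ∀ s ∈ Icc a b, ‖B s - A s - ((ν - μ) * (s - m)) • X s‖ ≤
      M * (b - a) ^ 2 * (ν - μ) ^ 2 := by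
    intro s hs
    have h := norm_taylor_sub_le hH' hH'' hM (hAm s hs) (hBm s hs)
    rw [show m + ν * (s - m) - (m + μ * (s - m)) = (ν - μ) * (s - m) by ring] at h
    refine h.trans ?_
    rw [mul_pow, ← sq_abs (s - m)]
    calc M * ((ν - μ) ^ 2 * |s - m| ^ 2) ≤ M * ((ν - μ) ^ 2 * (b - a) ^ 2) := by
          gcongr; exact hsm s hs
      _ = M * (b - a) ^ 2 * (ν - μ) ^ 2 := by ring
  have hQP : ∀ s ∈ Icc a b, ‖Q s - P s‖ ≤ K' * (b - a) * (b - a) * (ν - μ) := by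
    intro s hs
    refine (norm_timeOrderedExp_sub_le hA hAK hAs hB hBK hBs hs.1
      fun u hu => hBA u ⟨hu.1, hu.2.trans hs.2⟩).trans ?_
    calc K' * (b - a) * (ν - μ) * (s - a) ≤ K' * (b - a) * (ν - μ) * (b - a) := by
          gcongr; exact hs.2
      _ = K' * (b - a) * (b - a) * (ν - μ) := by ring
  refine (norm_timeOrderedExp_sub_le_norm_integral hA hAK hB hBK hBs a b).trans ?_
  set G := fun s => (s - m) • (star (P s) * (X s * P s)) with hG
  -- Two second-order errors: from replacing `Q` by `P`, and from linearizing `B - A`.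
  set R := fun s => star (Q s - P s) * ((B s - A s) * P s) +
    star (P s) * ((B s - A s - ((ν - μ) * (s - m)) • X s) * P s) with hR
  have hsplit : ∀ s, star (Q s) * ((B s - A s) * P s) = (ν - μ) • G s + R s := by
    intro s
    simp only [hG, hR, smul_smul, star_sub, sub_mul (star (Q s)), sub_mul (B s - A s),
      mul_sub (star (P s)), smul_mul_assoc, mul_smul_comm]
    abel
  have hGi : IntervalIntegrable G MeasureTheory.volume a b := by
    refine ContinuousOn.intervalIntegrable ?_
    rw [uIcc_of_le hab]
    fun_prop
  have hGi' : IntervalIntegrable (fun s => (ν - μ) • G s) MeasureTheory.volume a b :=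
    hGi.smul (ν - μ)
  have hRi : IntervalIntegrable R MeasureTheory.volume a b := by
    refine ContinuousOn.intervalIntegrable ?_
    rw [uIcc_of_le hab]
    fun_prop
  have hRle : ‖∫ s in a..b, R s‖ ≤
      ((K' * (b - a) * (b - a)) * (K' * (b - a)) + M * (b - a) ^ 2) * (ν - μ) ^ 2 * (b - a) := by
    refine (intervalIntegral.norm_integral_le_of_norm_le_const fun s hs => ?_).trans_eq
      (congrArg _ (abs_of_nonneg hba))
    rw [uIoc_of_le hab] at hs
    have hs' : s ∈ Icc a b := ⟨hs.1.le, hs.2⟩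
    refine (norm_add_le _ _).trans ?_
    have h1 : ‖star (Q s - P s) * ((B s - A s) * P s)‖ ≤
        (K' * (b - a) * (b - a) * (ν - μ)) * (K' * (b - a) * (ν - μ)) :=
      (norm_star_mul_mul_le (hP1 s)).trans
        (mul_le_mul (hQP s hs') (hBA s hs') (norm_nonneg _) (by positivity))
    have h2 : ‖star (P s) * ((B s - A s - ((ν - μ) * (s - m)) • X s) * P s)‖ ≤
        1 * (M * (b - a) ^ 2 * (ν - μ) ^ 2) :=
      (norm_star_mul_mul_le (hP1 s)).trans
        (mul_le_mul (hP1 s) (hTay s hs') (norm_nonneg _) zero_le_one)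
    linarith
  calc ‖∫ s in a..b, star (Q s) * ((B s - A s) * P s)‖
      = ‖(ν - μ) • (∫ s in a..b, G s) + ∫ s in a..b, R s‖ := by
        simp_rw [hsplit]
        rw [intervalIntegral.integral_add hGi' hRi,
          intervalIntegral.integral_smul]
    _ ≤ (ν - μ) * ‖∫ s in a..b, G s‖ + ‖∫ s in a..b, R s‖ := by
        refine (norm_add_le _ _).trans ?_
        rw [norm_smul, Real.norm_of_nonneg hδ]
    _ ≤ (ν - μ) * ((C + M * μ) * (b - a) ^ 3 / 12) +
        ((K' * (b - a) * (b - a)) * (K' * (b - a)) + M * (b - a) ^ 2) * (ν - μ) ^ 2 *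
          (b - a) := by gcongr
    _ = _ := by ring

/-- The error of a single midpoint step. -/
lemma norm_timeOrderedExp_sub_exp_midpoint_le {H H' H'' : ℝ → E →L[ℂ] E} {K M C a b : ℝ}
    (hab : a ≤ b) (hH : Continuous H) (hK : ∀ s, ‖H s‖ ≤ K) (hsa : ∀ s, IsSelfAdjoint (H s))
    (hH' : ∀ s ∈ Icc a b, HasDerivWithinAt H (H' s) (Icc a b) s)
    (hH'' : ∀ s ∈ Icc a b, HasDerivWithinAt H' (H'' s) (Icc a b) s)
    (hM : ∀ s ∈ Icc a b, ‖H'' s‖ ≤ M) (hC : ∀ s ∈ Icc a b, ‖⁅H' s, H s⁆‖ ≤ C) :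
    ‖timeOrderedExp H a b -
        NormedSpace.exp ((-Complex.I * ((b - a : ℝ) : ℂ)) • H ((a + b) / 2))‖ ≤
      (b - a) ^ 3 * (M / 24 + C / 12) := by
  -- `K'` enters only the quadratic coefficient, so it is absent from the final bound.
  obtain ⟨K', hK'⟩ := isCompact_Icc.exists_bound_of_continuousOn
    (f := H') (s := Icc a b) fun s hs => (hH'' s hs).continuousWithinAt
  have hM0 : 0 ≤ M := (norm_nonneg _).trans (hM a ⟨le_rfl, hab⟩)
  have hba : 0 ≤ b - a := sub_nonneg.2 hab
  have h := norm_sub_le_of_increment_le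
    (f := fun μ => timeOrderedExp (fun s => H ((a + b) / 2 + μ * (s - (a + b) / 2))) a b)
    (by positivity) fun μ ν hμ0 hμν hν1 => norm_timeOrderedExp_contraction_sub_le hab hH hK hsa
      hH' hH'' hK' hM hC hμ0 hμν hν1
  simp only [one_mul, zero_mul, add_zero, add_sub_cancel] at h
  rw [timeOrderedExp_const (hsa _)] at h
  exact h.trans_eq (by ring)

lemma midpointStep_eq (H : ℝ → E →L[ℂ] E) (Δ : ℝ) (j : ℕ) :
    midpointStep H Δ j = NormedSpace.exp ((-Complex.I *
      (((j + 1 : ℕ) * Δ - j * Δ : ℝ) : ℂ)) • H ((j * Δ + (j + 1 : ℕ) * Δ) / 2)) := by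
  rw [midpointStep]
  congr 4
  · push_cast; ring
  · push_cast; ring

lemma norm_midpointStep_le_one {H : ℝ → E →L[ℂ] E} (hsa : ∀ s, IsSelfAdjoint (H s)) (Δ : ℝ)
    (j : ℕ) : ‖midpointStep H Δ j‖ ≤ 1 := by
  rw [midpointStep_eq, ← timeOrderedExp_const (hsa _)]
  exact norm_timeOrderedExp_le_one continuous_const (fun _ => le_rfl) (fun _ => hsa _) _ _

lemma norm_midpointProduct_le_one {H : ℝ → E →L[ℂ] E} (hsa : ∀ s, IsSelfAdjoint (H s)) (Δ : ℝ)
    (n : ℕ) : ‖midpointProduct H Δ n‖ ≤ 1 := by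
  induction n with
  | zero => exact ContinuousLinearMap.norm_id_le
  | succ n ih =>
    exact (norm_mul_le _ _).trans
      (mul_le_one₀ (norm_midpointStep_le_one hsa Δ n) (norm_nonneg _) ih)

lemma norm_timeOrderedExp_sub_midpointProduct_le {H H' H'' : ℝ → E →L[ℂ] E} {K M C t Δ : ℝ}
    (hΔ : 0 ≤ Δ) (hH : Continuous H) (hK : ∀ s, ‖H s‖ ≤ K) (hsa : ∀ s, IsSelfAdjoint (H s))
    (hH' : ∀ s ∈ Icc 0 t, HasDerivWithinAt H (H' s) (Icc 0 t) s)
    (hH'' : ∀ s ∈ Icc 0 t, HasDerivWithinAt H' (H'' s) (Icc 0 t) s)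
    (hM : ∀ s ∈ Icc 0 t, ‖H'' s‖ ≤ M) (hC : ∀ s ∈ Icc 0 t, ‖⁅H' s, H s⁆‖ ≤ C)
    (n : ℕ) (hn : n * Δ ≤ t) :
    ‖timeOrderedExp H 0 (n * Δ) - midpointProduct H Δ n‖ ≤
      n * (Δ ^ 3 * (M / 24 + C / 12)) := by
  induction n with
  | zero => simp [timeOrderedExp_self, midpointProduct]
  | succ n ih =>
    have hstep : ((n + 1 : ℕ) : ℝ) * Δ - n * Δ = Δ := by push_cast; ring
    have hle : (n : ℝ) * Δ ≤ (n + 1 : ℕ) * Δ := by linarith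
    have hsub : Icc ((n : ℝ) * Δ) ((n + 1 : ℕ) * Δ) ⊆ Icc 0 t :=
      Icc_subset_Icc (by positivity) hn
    have hone := norm_timeOrderedExp_sub_exp_midpoint_le hle hH hK hsa
      (fun s hs => (hH' s (hsub hs)).mono hsub) (fun s hs => (hH'' s (hsub hs)).mono hsub)
      (fun s hs => hM s (hsub hs)) (fun s hs => hC s (hsub hs))
    rw [← midpointStep_eq, hstep] at hone
    have ih' := ih (hle.trans hn)
    -- Telescoping: each error is multiplied only by factors of norm at most one.
    have hsplit : timeOrderedExp H 0 ((n + 1 : ℕ) * Δ) - midpointProduct H Δ (n + 1) =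
        timeOrderedExp H (n * Δ) ((n + 1 : ℕ) * Δ) *
            (timeOrderedExp H 0 (n * Δ) - midpointProduct H Δ n) +
          (timeOrderedExp H (n * Δ) ((n + 1 : ℕ) * Δ) - midpointStep H Δ n) *
            midpointProduct H Δ n := by
      rw [mul_sub, sub_mul, timeOrderedExp_mul_timeOrderedExp hH hK hsa, midpointProduct]
      abel
    rw [hsplit]
    refine (norm_add_le _ _).trans ((add_le_add (norm_mul_le _ _) (norm_mul_le _ _)).trans ?_)
    have h1 := mul_le_of_le_one_left (norm_nonneg
      (timeOrderedExp H 0 (n * Δ) - midpointProduct H Δ n))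
      (norm_timeOrderedExp_le_one hH hK hsa (n * Δ) ((n + 1 : ℕ) * Δ))
    have h2 := mul_le_of_le_one_right (norm_nonneg
      (timeOrderedExp H (n * Δ) ((n + 1 : ℕ) * Δ) - midpointStep H Δ n))
      (norm_midpointProduct_le_one hsa Δ n)
    push_cast at *
    linarith

end Midpoint

/-! ### Assembly with values in `[0, ∞]`. -/

theorem mainTheorem5 {E : Type*} [NormedAddCommGroup E] [InnerProductSpace ℂ E] [CompleteSpace E]
    (t : ℝ) (ht : 0 ≤ t) (L : ℕ) (hL : 1 ≤ L)
    (H H' H'' : ℝ → E →L[ℂ] E)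
    (hsa : ∀ s ∈ Icc (0 : ℝ) t, IsSelfAdjoint (H s))
    (hH' : ∀ s ∈ Icc (0 : ℝ) t, HasDerivWithinAt H (H' s) (Icc (0 : ℝ) t) s)
    (hH'' : ∀ s ∈ Icc (0 : ℝ) t, HasDerivWithinAt H' (H'' s) (Icc (0 : ℝ) t) s) :
    Summable (fun n : ℕ => dysonTerm H 0 n t) ∧
      ‖timeOrderedExp H 0 t - midpointProduct H (t / L) L‖ₑ ≤
        ENNReal.ofReal (t ^ 3 / (L : ℝ) ^ 2) *
          (supSpectralNorm t H'' / 24 + supSpectralNorm t (fun s => ⁅H' s, H s⁆) / 12) := by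
  have hL0 : (0 : ℝ) < L := by exact_mod_cast hL
  have hLt : (L : ℝ) * (t / L) = t := by field_simp
  have hΔ : 0 ≤ t / L := by positivity
  have hHc : ContinuousOn H (Icc 0 t) := fun s hs => (hH' s hs).continuousWithinAt
  obtain ⟨K, hK⟩ := isCompact_Icc.exists_bound_of_continuousOn hHc
  -- Extending `H` by its end values makes it continuous, bounded and self-adjoint on all of `ℝ`, as
  -- the lemmas require.
  set F : ℝ → E →L[ℂ] E := IccExtend ht ((Icc 0 t).domRestrict H) with hF
  have hFH : EqOn H F (Icc 0 t) := fun s hs => by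
    rw [hF, IccExtend_of_mem ht _ hs, domRestrict_apply]
  have hFc : Continuous F := hHc.domRestrict.Icc_extend'
  have hFK : ∀ s, ‖F s‖ ≤ K := fun s => hK _ (projIcc 0 t ht s).2
  have hFs : ∀ s, IsSelfAdjoint (F s) := fun s => hsa _ (projIcc 0 t ht s).2
  have hFd : ∀ s ∈ Icc 0 t, HasDerivWithinAt F (H' s) (Icc 0 t) s := fun s hs =>
    (hH' s hs).congr (fun u hu => (hFH hu).symm) (hFH hs).symm
  have hterm : ∀ n, dysonTerm H 0 n t = dysonTerm F 0 n t := fun n =>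
    dysonTerm_congr hFH n ⟨ht, le_rfl⟩
  refine ⟨by simpa only [hterm] using summable_dysonTerm hFK 0 t, ?_⟩
  have hexp : timeOrderedExp H 0 t = timeOrderedExp F 0 t := tsum_congr hterm
  rw [hexp, midpointProduct_congr hFH hΔ L hLt.le]
  -- For `t > 0` the prefactor is positive, so an infinite supremum makes the right side infinite;
  -- `t = 0` is treated apart.
  rcases ht.eq_or_lt with rfl | ht0
  · have h := norm_timeOrderedExp_sub_midpointProduct_le (M := ‖H'' 0‖) (C := ‖⁅H' 0, F 0⁆‖)
      hΔ hFc hFK hFs hFd hH'' (fun s hs => ?_) (fun s hs => ?_) L hLt.le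
    · rw [hLt] at h
      have h0 : ‖timeOrderedExp F 0 0 - midpointProduct F (0 / L) L‖ = 0 :=
        le_antisymm (h.trans_eq (by simp)) (norm_nonneg _)
      rw [← ofReal_norm, h0]
      simp
    · rw [Icc_self, mem_singleton_iff] at hs; rw [hs]
    · rw [Icc_self, mem_singleton_iff] at hs; rw [hs]
  have hpos : 0 < t ^ 3 / (L : ℝ) ^ 2 := by positivity
  by_cases hM : supSpectralNorm t H'' = ⊤
  · simp [hM, ENNReal.top_div, ENNReal.mul_top, hpos]
  by_cases hC : supSpectralNorm t (fun s => ⁅H' s, H s⁆) = ⊤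
  · simp [hC, ENNReal.top_div, ENNReal.mul_top, hpos]
  have h := norm_timeOrderedExp_sub_midpointProduct_le hΔ hFc hFK hFs hFd hH''
    (fun s hs => norm_le_toReal_supSpectralNorm hM hs)
    (fun s hs => by
      rw [← hFH hs]
      exact norm_le_toReal_supSpectralNorm (A := fun s => ⁅H' s, H s⁆) hC hs) L hLt.le
  rw [hLt] at h
  have h24 : (24 : ℝ≥0∞) = ENNReal.ofReal 24 := by simp
  have h12 : (12 : ℝ≥0∞) = ENNReal.ofReal 12 := by simp
  rw [← ofReal_norm, ← ENNReal.ofReal_toReal hM, ← ENNReal.ofReal_toReal hC, h24, h12,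
    ← ENNReal.ofReal_div_of_pos (by norm_num), ← ENNReal.ofReal_div_of_pos (by norm_num),
    ← ENNReal.ofReal_add (by positivity) (by positivity), ← ENNReal.ofReal_mul hpos.le]
  refine ENNReal.ofReal_le_ofReal (h.trans_eq ?_)
  field_simp
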